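/- Let $d\ge 1$ be an integer, let $S^d=\{x\in\mathbb{R}^{d+1}:|x|=1\}$ with $|\cdot|$ the Euclidean norm, and let $0<\lambda<2$. Let $(a_n)_{n\ge 0}\subset S^d$ be a greedy $\lambda$-energy sequence, i.e. a sequence such that $$\sum_{k=0}^{n-1}|a_n-a_k|^\lambda=\max_{x\in S^d}\sum_{k=0}^{n-1}|x-a_k|^\lambda\qquad\text{for all } n\ge 1 .$$ Put $\alpha_N=(a_0,\dots,a_{N-1})$ and $$H_\lambda(\alpha_N)=\sum_{0\le i\ne j\le N-1}|a_i-a_j|^\lambda,\qquad \sigma_N=\frac1N\sum_{k=0}^{N-1}\delta_{a_k},\qquad I_\lambda(\sigma_d)=\iint_{S^d\times S^d}|x-y|^\lambda\,d\sigma_d(x)\,d\sigma_d(y),$$ where the first sum is over ordered pairs $(i,j)$, $\delta_a$ is the Dirac unit measure at $a$, and $\sigma_d$ is the uniform (normalized surface) probability measure on $S^d$. Then $$N(N-1)\,I_\lambda(\sigma_d)<H_\lambda(\alpha_N)<N^2\,I_\lambda(\sigma_d)\qquad\text{for all } N\ge 2 .$$ In particular, $$\lim_{N\to\infty}\frac{H_\lambda(\alpha_N)}{N^2}=I_\lambda(\sigma_d).$$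 Moreover, $\sigma_N$ converges weak-$*$ to $\sigma_d$, that is, $\int f\,d\sigma_N\to\int f\,d\sigma_d$ as $N\to\infty$ for every continuous $f:S^d\to\mathbb{R}$. -/

import Mathlib

open MeasureTheory Filter
open scoped Topology

noncomputable section

/-- The unit sphere `S^d` of `ℝ^(d+1)` (with the Euclidean norm). -/
abbrev UnitSphere (d : ℕ) : Type :=
  Metric.sphere (0 : EuclideanSpace ℝ (Fin (d + 1))) 1

/-- The kernel `|x - y|^lam`, with the Euclidean norm of `ℝ^(d+1)`. -/
def powKernel {d : ℕ} (lam : ℝ) (x y : UnitSphere d) : ℝ :=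
  ‖(x : EuclideanSpace ℝ (Fin (d + 1))) - (y : EuclideanSpace ℝ (Fin (d + 1)))‖ ^ lam

/-- The energy `∑_{i ≠ j} |y_i - y_j|^lam` over ordered pairs of a configuration of `N` points
that are not necessarily distinct. -/
def discreteEnergy {d : ℕ} (lam : ℝ) {N : ℕ} (y : Fin N → UnitSphere d) : ℝ :=
  ∑ i : Fin N, ∑ j : Fin N with i ≠ j, powKernel lam (y i) (y j)

/-- The discrete potential `U_n(x) = ∑_{k < n} |x - a_k|^lam`. -/
def discretePotential {d : ℕ} (lam : ℝ) (a : ℕ → UnitSphere d) (n : ℕ) (x : UnitSphere d) : ℝ :=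
  ∑ k ∈ Finset.range n, powKernel lam x (a k)

/-- `a` is a greedy energy sequence: for all `n ≥ 1`, `U_n(a_n) = max_{x ∈ S^d} U_n(x)`. -/
def IsGreedy {d : ℕ} (lam : ℝ) (a : ℕ → UnitSphere d) : Prop :=
  ∀ n : ℕ, 1 ≤ n →
    IsGreatest (Set.range (discretePotential lam a n)) (discretePotential lam a n (a n))

/-- The `N`-th section `(a_0, …, a_{N-1})` of a sequence. -/
def sequenceSection {d : ℕ} (a : ℕ → UnitSphere d) (N : ℕ) : Fin N → UnitSphere d :=
  fun i => a i

/-- The normalized counting measure `(1/N) ∑_{k < N} δ_{a_k}` (of interest for `N ≥ 1`). -/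
def countingMeasure {d : ℕ} (a : ℕ → UnitSphere d) (N : ℕ) : Measure (UnitSphere d) :=
  (N : ENNReal)⁻¹ • ∑ k ∈ Finset.range N, Measure.dirac (a k)

/-- The normalized uniform measure on `S^d`: the surface measure obtained from Lebesgue measure on
`ℝ^(d+1)` in polar coordinates, divided by its total mass. -/
def uniformMeasure (d : ℕ) : Measure (UnitSphere d) :=
  ((volume : Measure (EuclideanSpace ℝ (Fin (d + 1)))).toSphere Set.univ)⁻¹ •
    (volume : Measure (EuclideanSpace ℝ (Fin (d + 1)))).toSphere

instance uniformMeasure_isProbabilityMeasure (d : ℕ) :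
    IsProbabilityMeasure (uniformMeasure d) := by
  have : NeZero ((volume : Measure (EuclideanSpace ℝ (Fin (d + 1)))).toSphere) :=
    ⟨Measure.toSphere_ne_zero _⟩
  exact isProbabilityMeasureSMul

/-- The continuous energy `∬ |x - y|^lam dμ(x) dμ(y)`. For a finite measure and `lam > 0` the
integrand is continuous and bounded, hence integrable. -/
def continuousEnergy {d : ℕ} (lam : ℝ) (μ : Measure (UnitSphere d)) : ℝ :=
  ∫ x, ∫ y, powKernel lam x y ∂μ ∂μ

/-- Weak-star convergence of a sequence of measures on `S^d`: convergence of the integrals of every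
continuous real function. -/
def WeakStarTendsto {d : ℕ} (μs : ℕ → Measure (UnitSphere d)) (μ : Measure (UnitSphere d)) : Prop :=
  ∀ f : UnitSphere d → ℝ, Continuous f →
    Tendsto (fun n => ∫ x, f x ∂(μs n)) atTop (𝓝 (∫ x, f x ∂μ))

end

/-! Put s = lam/2, so 0 < s < 1. On the sphere |x - y|^lam = 2^s (1 - ⟨x, y⟩)^s, and 1 - (1 - u)^s
is a power series in u with positive coefficients c_k. Each ⟨x, y⟩^(k+1) is a sum of products m(x)
m(y) of monomials. Hence 2^(-s) (2 I(μ, ν) - I(μ, μ) - I(ν, ν)) is a series of squared moment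
differences with weights c_k (`hasSum_mutualEnergy`, `oneSubRpowCoeff_mul_sum_sq_le`).

For ν = σ_d, rotation invariance makes the cross energy I(μ, σ_d) equal to I(σ_d), so the energy
deficit of μ bounds every moment difference. Thus σ_d is the unique maximizer, and energies tending
to the maximum force weak-star convergence, by Stone–Weierstrass. The strict upper bound follows
because a finitely supported measure is not σ_d.

For the lower bound, the maximum of U_n is at least its mean n I(σ_d), and the energy grows by 2
U_n(a_n) at each step; strictness enters at n = 1. The two bounds squeeze H/N². -/

/-! ### The binomial series of 1 - (1 - u)^s on [-1, 1]. -/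

/-- The coefficients of the expansion `1 - (1 - u) ^ s = ∑ c_k u ^ (k + 1)`. -/
noncomputable def oneSubRpowCoeff (s : ℝ) (k : ℕ) : ℝ :=
  (-1) ^ k * Ring.choose s (k + 1)

theorem ringChoose_succ_mul (s : ℝ) (k : ℕ) :
    Ring.choose s (k + 1) * (k + 1) = Ring.choose s k * (s - k) := by
  have h1 := Ring.descPochhammer_eq_factorial_smul_choose s (k + 1)
  have h2 := Ring.descPochhammer_eq_factorial_smul_choose s k
  rw [descPochhammer_succ_right, Polynomial.smeval_mul, h2, Nat.factorial_succ] at h1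
  have h3 : ((k.factorial : ℕ) : ℝ) ≠ 0 := by positivity
  simp [Polynomial.smeval_natCast] at h1
  apply mul_left_cancel₀ h3
  linarith

/-- The recursion c_(k+1) (k + 2) = c_k (k + 1 - s) has positive factors because s < 1, and c_0 = s
> 0. -/
theorem oneSubRpowCoeff_pos {s : ℝ} (hs0 : 0 < s) (hs1 : s < 1) (k : ℕ) :
    0 < oneSubRpowCoeff s k := by
  induction k with
  | zero => simpa [oneSubRpowCoeff] using hs0
  | succ k ih =>
    have h := ringChoose_succ_mul s (k + 1)
    have hk : (0 : ℝ) < (k : ℝ) + 1 + 1 := by positivity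
    have h2 : oneSubRpowCoeff s (k + 1) * ((k : ℝ) + 1 + 1)
        = oneSubRpowCoeff s k * ((k : ℝ) + 1 - s) := by
      unfold oneSubRpowCoeff
      push_cast at h
      rw [pow_succ]
      linear_combination (-(-1) ^ k) * h
    have hk0 : (0 : ℝ) ≤ k := k.cast_nonneg
    have h3 : 0 < oneSubRpowCoeff s k * ((k : ℝ) + 1 - s) := mul_pos ih (by linarith)
    rw [← h2] at h3
    exact pos_of_mul_pos_left h3 hk.le

theorem hasSum_oneSubRpowCoeff_of_abs_lt (s : ℝ) {u : ℝ} (hu : |u| < 1) :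
    HasSum (fun k => oneSubRpowCoeff s k * u ^ (k + 1)) (1 - (1 - u) ^ s) := by
  have h0 := (Real.one_add_rpow_hasFPowerSeriesOnBall_zero (a := s)).hasSum (y := -u) (by
    simpa [enorm_eq_nnnorm, ← NNReal.coe_lt_coe] using hu)
  have h : HasSum (fun k => Ring.choose s k * (-u) ^ k) ((1 - u) ^ s) := by
    simpa [binomialSeries_apply, -FormalMultilinearSeries.apply_eq_prod_smul_coeff,
      List.ofFn_const, sub_eq_add_neg] using h0
  have h' := ((hasSum_nat_add_iff' 1).2 h).neg
  simp only [Finset.sum_range_one, Ring.choose_zero_right, pow_zero, mul_one, neg_sub] at h'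
  refine h'.congr_fun fun k => ?_
  rw [oneSubRpowCoeff, neg_pow u, pow_succ]
  ring

/-- For 0 < u < 1 the partial sums are at most 1 - (1 - u)^s ≤ 1; letting u → 1 bounds the partial
sums of the coefficients. -/
theorem summable_oneSubRpowCoeff {s : ℝ} (hs0 : 0 < s) (hs1 : s < 1) :
    Summable (oneSubRpowCoeff s) := by
  refine summable_of_sum_range_le (c := 1) (fun k => (oneSubRpowCoeff_pos hs0 hs1 k).le) fun n => ?_
  have hlim : Tendsto (fun u : ℝ => ∑ k ∈ Finset.range n, oneSubRpowCoeff s k * u ^ (k + 1))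
      (𝓝[<] 1) (𝓝 (∑ k ∈ Finset.range n, oneSubRpowCoeff s k)) := by
    have : Continuous fun u : ℝ => ∑ k ∈ Finset.range n, oneSubRpowCoeff s k * u ^ (k + 1) := by
      fun_prop
    simpa using (this.tendsto 1).mono_left nhdsWithin_le_nhds
  refine le_of_tendsto hlim ?_
  filter_upwards [Ioo_mem_nhdsLT (zero_lt_one' ℝ)] with u hu
  have h := hasSum_oneSubRpowCoeff_of_abs_lt s (u := u) (by rw [abs_of_pos hu.1]; exact hu.2)
  have h1 : 0 ≤ (1 - u) ^ s := Real.rpow_nonneg (by linarith [hu.2]) _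
  refine (sum_le_hasSum _ (fun k _ => ?_) h).trans (by linarith)
  exact mul_nonneg (oneSubRpowCoeff_pos hs0 hs1 k).le (pow_nonneg hu.1.le _)

theorem norm_oneSubRpowCoeff_mul_pow_le {s : ℝ} (hs0 : 0 < s) (hs1 : s < 1) {u : ℝ}
    (hu : |u| ≤ 1) (k : ℕ) : ‖oneSubRpowCoeff s k * u ^ (k + 1)‖ ≤ oneSubRpowCoeff s k := by
  rw [norm_mul, norm_pow, Real.norm_eq_abs, Real.norm_eq_abs,
    abs_of_pos (oneSubRpowCoeff_pos hs0 hs1 k)]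
  exact mul_le_of_le_one_right (oneSubRpowCoeff_pos hs0 hs1 k).le
    (pow_le_one₀ (abs_nonneg _) hu)

/-- The endpoints u = ±1 are needed, being the inner products of x with x and -x. They are reached
by continuity: the coefficients dominate the series uniformly on [-1, 1]. -/
theorem hasSum_oneSubRpowCoeff {s : ℝ} (hs0 : 0 < s) (hs1 : s < 1) {u : ℝ} (hu : |u| ≤ 1) :
    HasSum (fun k => oneSubRpowCoeff s k * u ^ (k + 1)) (1 - (1 - u) ^ s) := by
  have hsum : Summable fun k => oneSubRpowCoeff s k * u ^ (k + 1) :=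
    (summable_oneSubRpowCoeff hs0 hs1).of_norm_bounded
      (norm_oneSubRpowCoeff_mul_pow_le hs0 hs1 hu)
  have hcont : ContinuousOn (fun v : ℝ => ∑' k, oneSubRpowCoeff s k * v ^ (k + 1))
      (Set.Icc (-1) 1) :=
    continuousOn_tsum (fun k => by fun_prop) (summable_oneSubRpowCoeff hs0 hs1)
      fun k v hv => norm_oneSubRpowCoeff_mul_pow_le hs0 hs1 (abs_le.2 hv) k
  have hcont' : ContinuousOn (fun v : ℝ => 1 - (1 - v) ^ s) (Set.Icc (-1) 1) :=
    (continuous_const.sub ((continuous_const.sub continuous_id).rpow_const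
      fun _ => Or.inr hs0.le)).continuousOn
  have heq : Set.EqOn (fun v : ℝ => ∑' k, oneSubRpowCoeff s k * v ^ (k + 1))
      (fun v : ℝ => 1 - (1 - v) ^ s) (Set.Icc (-1) 1) := by
    refine Set.EqOn.of_subset_closure (s := Set.Ioo (-1) 1) (fun v hv => ?_) hcont hcont'
      Set.Ioo_subset_Icc_self ?_
    · exact (hasSum_oneSubRpowCoeff_of_abs_lt s (abs_lt.2 hv)).tsum_eq
    · rw [closure_Ioo (by norm_num)]
  rw [← show _ = 1 - (1 - u) ^ s from heq (abs_le.1 hu)]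
  exact hsum.hasSum

/-! ### Monomials and the kernel on the sphere. -/

variable {d : ℕ}

/-- The monomial `∏ j, x_{f j}` on the sphere. -/
def sphereMonomial {k : ℕ} (f : Fin k → Fin (d + 1)) : C(UnitSphere d, ℝ) where
  toFun x := ∏ j, (x : EuclideanSpace ℝ (Fin (d + 1))) (f j)
  continuous_toFun := by fun_prop

theorem sphereMonomial_apply {k : ℕ} (f : Fin k → Fin (d + 1)) (x : UnitSphere d) :
    sphereMonomial f x = ∏ j, (x : EuclideanSpace ℝ (Fin (d + 1))) (f j) := rfl

theorem inner_pow_eq_sum_sphereMonomial (x y : UnitSphere d) (k : ℕ) :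
    inner ℝ (x : EuclideanSpace ℝ (Fin (d + 1))) (y : EuclideanSpace ℝ (Fin (d + 1))) ^ k
      = ∑ f : Fin k → Fin (d + 1), sphereMonomial f x * sphereMonomial f y := by
  rw [PiLp.inner_apply, Fintype.sum_pow]
  refine Finset.sum_congr rfl fun f _ => ?_
  simp [sphereMonomial_apply, Finset.prod_mul_distrib, mul_comm]

theorem abs_inner_unitSphere_le (x y : UnitSphere d) :
    |inner ℝ (x : EuclideanSpace ℝ (Fin (d + 1))) (y : EuclideanSpace ℝ (Fin (d + 1)))| ≤ 1 := by
  simpa using abs_real_inner_le_norm (x : EuclideanSpace ℝ (Fin (d + 1))) y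

theorem powKernel_eq_inner (lam : ℝ) (x y : UnitSphere d) :
    powKernel lam x y = 2 ^ (lam / 2) *
      (1 - inner ℝ (x : EuclideanSpace ℝ (Fin (d + 1)))
        (y : EuclideanSpace ℝ (Fin (d + 1)))) ^ (lam / 2) := by
  have h1 := (abs_le.1 (abs_inner_unitSphere_le x y)).2
  rw [← Real.mul_rpow (by norm_num) (by linarith)]
  have h := norm_sub_sq_real (x : EuclideanSpace ℝ (Fin (d + 1))) y
  simp only [norm_eq_of_mem_sphere] at h
  rw [show 2 * (1 - inner ℝ (x : EuclideanSpace ℝ (Fin (d + 1)))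
      (y : EuclideanSpace ℝ (Fin (d + 1))))
    = ‖(x : EuclideanSpace ℝ (Fin (d + 1))) - y‖ ^ (2 : ℝ) by rw [Real.rpow_two, h]; ring,
    ← Real.rpow_mul (norm_nonneg _), mul_div_cancel₀ _ (two_ne_zero' ℝ)]
  rfl

theorem continuous_powKernel {lam : ℝ} (hlam : 0 < lam) :
    Continuous fun p : UnitSphere d × UnitSphere d => powKernel lam p.1 p.2 := by
  unfold powKernel
  exact Continuous.rpow_const (by fun_prop) fun _ => Or.inr hlam.le

theorem integrable_of_continuous_compact {X : Type*} [TopologicalSpace X] [CompactSpace X]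
    [MeasurableSpace X] [OpensMeasurableSpace X] (μ : Measure X) [IsFiniteMeasure μ]
    {f : X → ℝ} (hf : Continuous f) : Integrable f μ :=
  BoundedContinuousFunction.integrable μ (BoundedContinuousFunction.mkOfCompact ⟨f, hf⟩)

/-! ### Energy as a series of products of moments. -/

/-- The mutual energy `∬ |x - y|^lam dν(y) dμ(x)`. -/
noncomputable def mutualEnergy (lam : ℝ) (μ ν : Measure (UnitSphere d)) : ℝ :=
  ∫ x, ∫ y, powKernel lam x y ∂ν ∂μ

theorem hasSum_mutualEnergy {lam : ℝ} (h0 : 0 < lam) (h2 : lam < 2)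
    (μ ν : Measure (UnitSphere d)) [IsProbabilityMeasure μ] [IsProbabilityMeasure ν] :
    HasSum (fun k => oneSubRpowCoeff (lam / 2) k * ∑ f : Fin (k + 1) → Fin (d + 1),
        (∫ x, sphereMonomial f x ∂μ) * ∫ x, sphereMonomial f x ∂ν)
      (1 - 2 ^ (-(lam / 2)) * mutualEnergy lam μ ν) := by
  have hs0 : 0 < lam / 2 := by linarith
  have hs1 : lam / 2 < 1 := by linarith
  set c := oneSubRpowCoeff (lam / 2)
  set F : ℕ → UnitSphere d × UnitSphere d → ℝ := fun k p =>
    c k * inner ℝ (p.1 : EuclideanSpace ℝ (Fin (d + 1)))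
      (p.2 : EuclideanSpace ℝ (Fin (d + 1))) ^ (k + 1) with hF
  have hFc : ∀ k, Continuous (F k) := fun k => by fun_prop
  have hFle : ∀ k p, ‖F k p‖ ≤ c k := fun k p =>
    norm_oneSubRpowCoeff_mul_pow_le hs0 hs1 (abs_inner_unitSphere_le p.1 p.2) k
  have hFi : ∀ k, Integrable (F k) (μ.prod ν) := fun k =>
    integrable_of_continuous_compact _ (hFc k)
  have hsum : Summable fun k => ∫ p, ‖F k p‖ ∂(μ.prod ν) := by
    refine (summable_oneSubRpowCoeff hs0 hs1).of_nonneg_of_le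
      (fun k => integral_nonneg fun _ => norm_nonneg _) fun k => ?_
    calc ∫ p, ‖F k p‖ ∂(μ.prod ν) ≤ ∫ _, c k ∂(μ.prod ν) :=
          integral_mono (hFi k).norm (integrable_const _) (hFle k)
      _ = c k := by simp
  have key := hasSum_integral_of_summable_integral_norm hFi hsum
  have hint : Integrable (fun p : UnitSphere d × UnitSphere d => powKernel lam p.1 p.2)
      (μ.prod ν) := integrable_of_continuous_compact _ (continuous_powKernel h0)
  convert! key using 1
  · funext k
    simp only [hF, inner_pow_eq_sum_sphereMonomial]
    rw [integral_const_mul, integral_finsetSum]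
    · simp only [integral_prod_mul]
    · intro f _
      exact integrable_of_continuous_compact _ (by fun_prop)
  · have hts : ∀ p : UnitSphere d × UnitSphere d,
        ∑' k, F k p = 1 - 2 ^ (-(lam / 2)) * powKernel lam p.1 p.2 := by
      intro p
      rw [(hasSum_oneSubRpowCoeff hs0 hs1 (abs_inner_unitSphere_le p.1 p.2)).tsum_eq,
        powKernel_eq_inner, ← mul_assoc, ← Real.rpow_add (by norm_num)]
      simp
    simp only [hts]
    rw [integral_sub (integrable_const _) (hint.const_mul _), integral_const_mul,
      integral_prod _ hint, mutualEnergy]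
    simp

/-- Polarizing the moment expansion turns products into squares; a single term of a nonnegative
series is at most its sum. -/
theorem oneSubRpowCoeff_mul_sum_sq_le {lam : ℝ} (h0 : 0 < lam) (h2 : lam < 2)
    (μ ν : Measure (UnitSphere d)) [IsProbabilityMeasure μ] [IsProbabilityMeasure ν] (k : ℕ) :
    oneSubRpowCoeff (lam / 2) k * ∑ f : Fin (k + 1) → Fin (d + 1),
        (∫ x, sphereMonomial f x ∂μ - ∫ x, sphereMonomial f x ∂ν) ^ 2
      ≤ 2 ^ (-(lam / 2)) *
        (2 * mutualEnergy lam μ ν - mutualEnergy lam μ μ - mutualEnergy lam ν ν) := by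
  have h := ((hasSum_mutualEnergy h0 h2 μ μ).add (hasSum_mutualEnergy h0 h2 ν ν)).sub
    ((hasSum_mutualEnergy h0 h2 μ ν).mul_left 2)
  have h' : HasSum (fun k => oneSubRpowCoeff (lam / 2) k * ∑ f : Fin (k + 1) → Fin (d + 1),
      (∫ x, sphereMonomial f x ∂μ - ∫ x, sphereMonomial f x ∂ν) ^ 2) (2 ^ (-(lam / 2)) *
        (2 * mutualEnergy lam μ ν - mutualEnergy lam μ μ - mutualEnergy lam ν ν)) := by
    convert! h using 1
    · funext k
      rw [← mul_add, ← Finset.sum_add_distrib, mul_left_comm, ← mul_sub,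
        Finset.mul_sum Finset.univ _ (2 : ℝ), ← Finset.sum_sub_distrib]
      congr 1
      exact Finset.sum_congr rfl fun f _ => by ring
    · ring
  refine le_hasSum h' k fun j _ => ?_
  exact mul_nonneg (oneSubRpowCoeff_pos (by linarith) (by linarith) j).le
    (Finset.sum_nonneg fun f _ => sq_nonneg _)

/-! ### From convergence of moments to weak-star convergence. -/

theorem sphereMonomial_mul {k l : ℕ} (f : Fin k → Fin (d + 1)) (g : Fin l → Fin (d + 1)) :
    sphereMonomial f * sphereMonomial g = sphereMonomial (Fin.append f g) := by
  ext x
  simp [sphereMonomial_apply, Fin.prod_univ_add]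

theorem topologicalClosure_adjoin_coordinates :
    (Algebra.adjoin ℝ (Set.range fun i : Fin (d + 1) =>
      sphereMonomial (d := d) (k := 1) fun _ => i)).topologicalClosure = ⊤ := by
  refine ContinuousMap.subalgebra_topologicalClosure_eq_top_of_separatesPoints _ ?_
  intro x y hxy
  obtain ⟨i, hi⟩ : ∃ i, (x : EuclideanSpace ℝ (Fin (d + 1))) i ≠
      (y : EuclideanSpace ℝ (Fin (d + 1))) i := by
    by_contra! h
    exact hxy (Subtype.ext (PiLp.ext h))
  exact ⟨_, ⟨_, Algebra.subset_adjoin ⟨i, rfl⟩, rfl⟩, by simpa [sphereMonomial_apply] using hi⟩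

theorem exists_eq_sphereMonomial_of_mem_closure {g : C(UnitSphere d, ℝ)}
    (hg : g ∈ Submonoid.closure (Set.range fun i : Fin (d + 1) =>
      sphereMonomial (d := d) (k := 1) fun _ => i)) :
    ∃ (k : ℕ) (f : Fin k → Fin (d + 1)), g = sphereMonomial f := by
  induction hg using Submonoid.closure_induction with
  | mem g hg =>
    obtain ⟨i, rfl⟩ := hg
    exact ⟨1, fun _ => i, rfl⟩
  | one =>
    refine ⟨0, Fin.elim0, ?_⟩
    ext x
    simp [sphereMonomial_apply]
  | mul g h _ _ hg hh =>
    obtain ⟨k, f, rfl⟩ := hg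
    obtain ⟨l, f', rfl⟩ := hh
    exact ⟨_, _, sphereMonomial_mul f f'⟩

theorem abs_integral_sub_integral_le (μ : Measure (UnitSphere d)) [IsProbabilityMeasure μ]
    (f g : C(UnitSphere d, ℝ)) : |∫ x, f x ∂μ - ∫ x, g x ∂μ| ≤ ‖f - g‖ := by
  rw [← integral_sub (integrable_of_continuous_compact μ f.continuous)
    (integrable_of_continuous_compact μ g.continuous)]
  simpa using norm_integral_le_of_norm_le_const (μ := μ)
    (Eventually.of_forall fun x => (f - g).norm_coe_le_norm x)

/-- Convergence of all moments implies weak-star convergence on the sphere. -/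
theorem weakStarTendsto_of_tendsto_sphereMonomial {μs : ℕ → Measure (UnitSphere d)}
    {μ : Measure (UnitSphere d)} [∀ n, IsProbabilityMeasure (μs n)] [IsProbabilityMeasure μ]
    (h : ∀ (k : ℕ) (f : Fin k → Fin (d + 1)),
      Tendsto (fun n => ∫ x, sphereMonomial f x ∂(μs n)) atTop (𝓝 (∫ x, sphereMonomial f x ∂μ))) :
    WeakStarTendsto μs μ := by
  intro f hf
  set F : C(UnitSphere d, ℝ) := ⟨f, hf⟩
  set A := Algebra.adjoin ℝ (Set.range fun i : Fin (d + 1) =>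
    sphereMonomial (d := d) (k := 1) fun _ => i) with hA
  have hpoly : ∀ g ∈ A, Tendsto (fun n => ∫ x, g x ∂(μs n)) atTop (𝓝 (∫ x, g x ∂μ)) := by
    intro g hg
    -- The generated algebra is the linear span of the monomials, so convergence extends by
    -- linearity.
    rw [← Subalgebra.mem_toSubmodule, hA, Algebra.adjoin_eq_span] at hg
    induction hg using Submodule.span_induction with
    | mem g hg =>
      obtain ⟨k, f, rfl⟩ := exists_eq_sphereMonomial_of_mem_closure hg
      exact h k f
    | zero => simp
    | add g g' _ _ hg hg' =>
      have hadd : ∀ (ν : Measure (UnitSphere d)) [IsProbabilityMeasure ν],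
          ∫ x, (g + g') x ∂ν = ∫ x, g x ∂ν + ∫ x, g' x ∂ν := fun ν _ =>
        integral_add (integrable_of_continuous_compact ν g.continuous)
          (integrable_of_continuous_compact ν g'.continuous)
      simpa only [hadd] using hg.add hg'
    | smul c g _ hg =>
      have hsmul : ∀ ν : Measure (UnitSphere d), ∫ x, (c • g) x ∂ν = c * ∫ x, g x ∂ν := fun ν =>
        integral_const_mul c _
      simpa only [hsmul] using hg.const_mul c
  rw [Metric.tendsto_atTop]
  intro ε hε
  have hmem : F ∈ A.topologicalClosure := by
    rw [hA, topologicalClosure_adjoin_coordinates]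
    trivial
  obtain ⟨g, hgA, hg⟩ := Metric.mem_closure_iff.1 hmem (ε / 3) (by positivity)
  rw [dist_eq_norm] at hg
  obtain ⟨N, hN⟩ := Metric.tendsto_atTop.1 (hpoly g hgA) (ε / 3) (by positivity)
  refine ⟨N, fun n hn => ?_⟩
  have h1 := hN n hn
  have h2 := abs_integral_sub_integral_le (μs n) F g
  have h3 := abs_integral_sub_integral_le μ F g
  rw [Real.dist_eq] at h1 ⊢
  have e : ∀ x, F x = f x := fun _ => rfl
  simp only [e] at h2 h3
  rw [abs_lt] at h1 ⊢
  rw [abs_le] at h2 h3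
  constructor <;> linarith

/-! ### Rotation invariance of the uniform measure. -/

open scoped Pointwise

/-- The homeomorphism of the sphere induced by a linear isometry. -/
noncomputable def sphereHomeomorph
    (φ : EuclideanSpace ℝ (Fin (d + 1)) ≃ₗᵢ[ℝ] EuclideanSpace ℝ (Fin (d + 1))) :
    UnitSphere d ≃ₜ UnitSphere d :=
  φ.toHomeomorph.subtype fun x => by simp

theorem coe_sphereHomeomorph
    (φ : EuclideanSpace ℝ (Fin (d + 1)) ≃ₗᵢ[ℝ] EuclideanSpace ℝ (Fin (d + 1)))
    (x : UnitSphere d) : (sphereHomeomorph φ x : EuclideanSpace ℝ (Fin (d + 1))) = φ x := rfl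

/-- The surface measure of s is a constant times the volume of the cone (0, 1) • s, and a linear
isometry preserves volume and maps cones to cones. -/
theorem measurePreserving_sphereHomeomorph_toSphere
    (φ : EuclideanSpace ℝ (Fin (d + 1)) ≃ₗᵢ[ℝ] EuclideanSpace ℝ (Fin (d + 1))) :
    MeasurePreserving (sphereHomeomorph φ)
      (volume : Measure (EuclideanSpace ℝ (Fin (d + 1)))).toSphere
      (volume : Measure (EuclideanSpace ℝ (Fin (d + 1)))).toSphere := by
  refine ⟨(sphereHomeomorph φ).measurable, Measure.ext fun s hs => ?_⟩
  have hpre : MeasurableSet (sphereHomeomorph φ ⁻¹' s) := (sphereHomeomorph φ).measurable hs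
  rw [Measure.map_apply (sphereHomeomorph φ).measurable hs, Measure.toSphere_apply' _ hpre,
    Measure.toSphere_apply' _ hs]
  congr 1
  have hset : Set.Ioo (0 : ℝ) 1 • ((↑) '' (sphereHomeomorph φ ⁻¹' s) :
        Set (EuclideanSpace ℝ (Fin (d + 1))))
      = φ ⁻¹' (Set.Ioo (0 : ℝ) 1 • ((↑) '' s)) := by
    ext v
    simp only [Set.mem_smul, Set.mem_image, Set.mem_preimage]
    constructor
    · rintro ⟨r, hr, _, ⟨x, hx, rfl⟩, rfl⟩
      exact ⟨r, hr, _, ⟨_, hx, rfl⟩, by simp [coe_sphereHomeomorph]⟩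
    · rintro ⟨r, hr, _, ⟨x, hx, rfl⟩, hv⟩
      refine ⟨r, hr, _, ⟨(sphereHomeomorph φ).symm x, by simpa using hx, rfl⟩, ?_⟩
      apply φ.injective
      rw [← hv, map_smul, ← coe_sphereHomeomorph, Homeomorph.apply_symm_apply]
  rw [hset]
  exact φ.measurePreserving.measure_preimage_equiv (f := φ.toMeasurableEquiv) _

theorem measurePreserving_sphereHomeomorph
    (φ : EuclideanSpace ℝ (Fin (d + 1)) ≃ₗᵢ[ℝ] EuclideanSpace ℝ (Fin (d + 1))) :
    MeasurePreserving (sphereHomeomorph φ) (uniformMeasure d) (uniformMeasure d) :=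
  (measurePreserving_sphereHomeomorph_toSphere φ).smul_measure _

instance uniformMeasure_isOpenPosMeasure (d : ℕ) : (uniformMeasure d).IsOpenPosMeasure := by
  unfold uniformMeasure
  refine ⟨fun U hU hne => ?_⟩
  rw [Measure.smul_apply, smul_eq_mul]
  exact mul_ne_zero (ENNReal.inv_ne_zero.2 (measure_ne_top _ _)) (hU.measure_ne_zero _ hne)

theorem integral_powKernel_uniformMeasure_eq (lam : ℝ) (x x' : UnitSphere d) :
    ∫ y, powKernel lam x y ∂(uniformMeasure d) = ∫ y, powKernel lam x' y ∂(uniformMeasure d) := by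
  -- Reflection in the hyperplane orthogonal to x - x', which exchanges x and x'.
  set φ := (ℝ ∙ ((x : EuclideanSpace ℝ (Fin (d + 1))) - x'))ᗮ.reflection
  have hx : φ (x : EuclideanSpace ℝ (Fin (d + 1))) = x' :=
    Submodule.reflection_sub (by simp)
  rw [← (measurePreserving_sphereHomeomorph φ).integral_comp
    (sphereHomeomorph φ).measurableEmbedding fun y => powKernel lam x' y]
  refine integral_congr_ae (Eventually.of_forall fun y => ?_)
  simp only [powKernel, coe_sphereHomeomorph]
  rw [← hx, ← map_sub, LinearIsometryEquiv.norm_map]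

theorem integral_powKernel_uniformMeasure (lam : ℝ) (x : UnitSphere d) :
    ∫ y, powKernel lam x y ∂(uniformMeasure d) = continuousEnergy lam (uniformMeasure d) := by
  unfold continuousEnergy
  simp only [fun x' => integral_powKernel_uniformMeasure_eq lam x' x]
  simp

theorem mutualEnergy_uniformMeasure_right (lam : ℝ) (μ : Measure (UnitSphere d))
    [IsProbabilityMeasure μ] :
    mutualEnergy lam μ (uniformMeasure d) = continuousEnergy lam (uniformMeasure d) := by
  simp only [mutualEnergy, integral_powKernel_uniformMeasure]
  simp

/-! ### The uniform measure as unique energy maximizer. -/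

/-- The energy deficit of a probability measure controls its moments. -/
theorem oneSubRpowCoeff_mul_sum_sq_uniformMeasure_le {lam : ℝ} (h0 : 0 < lam) (h2 : lam < 2)
    (μ : Measure (UnitSphere d)) [IsProbabilityMeasure μ] (k : ℕ) :
    oneSubRpowCoeff (lam / 2) k * ∑ f : Fin (k + 1) → Fin (d + 1),
        (∫ x, sphereMonomial f x ∂μ - ∫ x, sphereMonomial f x ∂(uniformMeasure d)) ^ 2
      ≤ 2 ^ (-(lam / 2)) *
        (continuousEnergy lam (uniformMeasure d) - mutualEnergy lam μ μ) := by
  refine (oneSubRpowCoeff_mul_sum_sq_le h0 h2 μ (uniformMeasure d) k).trans_eq ?_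
  simp only [mutualEnergy_uniformMeasure_right]
  ring

theorem weakStarTendsto_uniformMeasure_of_tendsto_energy {lam : ℝ} (h0 : 0 < lam) (h2 : lam < 2)
    (μs : ℕ → Measure (UnitSphere d)) [∀ n, IsProbabilityMeasure (μs n)]
    (h : Tendsto (fun n => mutualEnergy lam (μs n) (μs n)) atTop
      (𝓝 (continuousEnergy lam (uniformMeasure d)))) :
    WeakStarTendsto μs (uniformMeasure d) := by
  refine weakStarTendsto_of_tendsto_sphereMonomial fun k f => ?_
  cases k with
  | zero => simp [sphereMonomial_apply]
  | succ k =>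
    have hc := oneSubRpowCoeff_pos (s := lam / 2) (by linarith) (by linarith) k
    rw [tendsto_iff_dist_tendsto_zero]
    have hsq : Tendsto (fun n => (∫ x, sphereMonomial f x ∂(μs n)
        - ∫ x, sphereMonomial f x ∂(uniformMeasure d)) ^ 2) atTop (𝓝 0) := by
      have hub : Tendsto (fun n => 2 ^ (-(lam / 2)) * (continuousEnergy lam (uniformMeasure d)
          - mutualEnergy lam (μs n) (μs n)) / oneSubRpowCoeff (lam / 2) k) atTop (𝓝 0) := by
        simpa using ((h.const_sub (continuousEnergy lam (uniformMeasure d))).const_mul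
          ((2 : ℝ) ^ (-(lam / 2)))).div_const (oneSubRpowCoeff (lam / 2) k)
      refine squeeze_zero (fun n => sq_nonneg _) (fun n => ?_) hub
      rw [le_div_iff₀' hc]
      refine le_trans ?_ (oneSubRpowCoeff_mul_sum_sq_uniformMeasure_le h0 h2 (μs n) k)
      refine mul_le_mul_of_nonneg_left ?_ hc.le
      exact Finset.single_le_sum (f := fun f : Fin (k + 1) → Fin (d + 1) =>
        (∫ x, sphereMonomial f x ∂(μs n) - ∫ x, sphereMonomial f x ∂(uniformMeasure d)) ^ 2)
        (fun f _ => sq_nonneg _) (Finset.mem_univ f)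
    simpa [Real.sqrt_sq_eq_abs, Real.dist_eq] using hsq.sqrt

theorem mutualEnergy_self_le_continuousEnergy {lam : ℝ} (h0 : 0 < lam) (h2 : lam < 2)
    (μ : Measure (UnitSphere d)) [IsProbabilityMeasure μ] :
    mutualEnergy lam μ μ ≤ continuousEnergy lam (uniformMeasure d) := by
  have h := oneSubRpowCoeff_mul_sum_sq_uniformMeasure_le h0 h2 μ 0
  have hc := oneSubRpowCoeff_pos (s := lam / 2) (by linarith) (by linarith) 0
  have h1 := (mul_nonneg hc.le (Finset.sum_nonneg fun f _ => sq_nonneg _)).trans h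
  exact sub_nonneg.1 (nonneg_of_mul_nonneg_right h1 (by positivity))

/-- The uniform measure is the unique maximizer of the energy. -/
theorem integral_eq_of_mutualEnergy_self_eq {lam : ℝ} (h0 : 0 < lam) (h2 : lam < 2)
    (μ : Measure (UnitSphere d)) [IsProbabilityMeasure μ]
    (h : mutualEnergy lam μ μ = continuousEnergy lam (uniformMeasure d))
    {f : UnitSphere d → ℝ} (hf : Continuous f) :
    ∫ x, f x ∂μ = ∫ x, f x ∂(uniformMeasure d) := by
  -- The constant sequence μ has converging energies, so μ is its own limit and also has the
  -- integrals of the uniform measure.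
  have := weakStarTendsto_uniformMeasure_of_tendsto_energy h0 h2 (fun _ => μ)
    (by rw [h]; exact tendsto_const_nhds) f hf
  exact tendsto_nhds_unique tendsto_const_nhds this

/-! ### Greedy sequences: the lower bound. -/

theorem powKernel_self {lam : ℝ} (h0 : 0 < lam) (x : UnitSphere d) : powKernel lam x x = 0 := by
  simp [powKernel, Real.zero_rpow h0.ne']

theorem powKernel_comm (lam : ℝ) (x y : UnitSphere d) : powKernel lam x y = powKernel lam y x := by
  simp only [powKernel, norm_sub_rev]

theorem discreteEnergy_sequenceSection {lam : ℝ} (h0 : 0 < lam) (a : ℕ → UnitSphere d) (N : ℕ) :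
    discreteEnergy lam (sequenceSection a N)
      = ∑ i ∈ Finset.range N, ∑ j ∈ Finset.range N, powKernel lam (a i) (a j) := by
  unfold discreteEnergy sequenceSection
  rw [← Fin.sum_univ_eq_sum_range fun i => ∑ j ∈ Finset.range N, powKernel lam (a i) (a j)]
  refine Finset.sum_congr rfl fun i _ => ?_
  rw [← Fin.sum_univ_eq_sum_range fun j => powKernel lam (a i) (a j), Finset.sum_filter]
  refine Finset.sum_congr rfl fun j _ => ?_
  split_ifs with h
  · rfl
  · rw [not_not.1 h, powKernel_self h0]

theorem discreteEnergy_sequenceSection_succ {lam : ℝ} (h0 : 0 < lam) (a : ℕ → UnitSphere d)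
    (N : ℕ) :
    discreteEnergy lam (sequenceSection a (N + 1))
      = discreteEnergy lam (sequenceSection a N) + 2 * discretePotential lam a N (a N) := by
  simp only [discreteEnergy_sequenceSection h0, Finset.sum_range_succ, Finset.sum_add_distrib,
    powKernel_self h0, discretePotential, powKernel_comm lam _ (a N)]
  ring

theorem continuous_powKernel_left {lam : ℝ} (h0 : 0 < lam) (y : UnitSphere d) :
    Continuous fun x => powKernel lam x y := by
  unfold powKernel
  exact Continuous.rpow_const (by fun_prop) fun _ => Or.inr h0.le

theorem integral_discretePotential {lam : ℝ} (h0 : 0 < lam) (a : ℕ → UnitSphere d) (n : ℕ) :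
    ∫ x, discretePotential lam a n x ∂(uniformMeasure d)
      = n * continuousEnergy lam (uniformMeasure d) := by
  unfold discretePotential
  rw [integral_finsetSum _ fun k _ =>
    integrable_of_continuous_compact _ (continuous_powKernel_left h0 (a k))]
  simp only [fun x k => powKernel_comm lam x (a k), integral_powKernel_uniformMeasure]
  simp

theorem continuous_discretePotential {lam : ℝ} (h0 : 0 < lam) (a : ℕ → UnitSphere d) (n : ℕ) :
    Continuous (discretePotential lam a n) :=
  continuous_finsetSum _ fun k _ => continuous_powKernel_left h0 (a k)

/-- The maximum of the potential is at least its mean over the sphere. -/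
theorem IsGreedy.mul_continuousEnergy_le {lam : ℝ} (h0 : 0 < lam) {a : ℕ → UnitSphere d}
    (ha : IsGreedy lam a) (n : ℕ) :
    n * continuousEnergy lam (uniformMeasure d) ≤ discretePotential lam a n (a n) := by
  rcases Nat.eq_zero_or_pos n with rfl | hn
  · simp [discretePotential]
  rw [← integral_discretePotential h0 a n]
  calc ∫ x, discretePotential lam a n x ∂(uniformMeasure d)
      ≤ ∫ _, discretePotential lam a n (a n) ∂(uniformMeasure d) :=
        integral_mono (integrable_of_continuous_compact _ (continuous_discretePotential h0 a n))
          (integrable_const _) fun x => (ha n hn).2 ⟨x, rfl⟩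
    _ = discretePotential lam a n (a n) := by simp

theorem integral_pos_of_continuous {f : UnitSphere d → ℝ} (hf : Continuous f) (h : 0 ≤ f)
    {x : UnitSphere d} (hx : f x ≠ 0) : 0 < ∫ y, f y ∂(uniformMeasure d) :=
  (integral_pos_iff_support_of_nonneg h (integrable_of_continuous_compact _ hf)).2
    (hf.isOpen_support.measure_pos _ ⟨x, hx⟩)

/-- The maximum exceeds the mean strictly because U_1 is not constant: it vanishes at a_0 and is
positive at -a_0. -/
theorem continuousEnergy_lt_discretePotential_one {lam : ℝ} (h0 : 0 < lam) {a : ℕ → UnitSphere d}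
    (ha : IsGreedy lam a) :
    continuousEnergy lam (uniformMeasure d) < discretePotential lam a 1 (a 1) := by
  have hle : ∀ x, discretePotential lam a 1 x ≤ discretePotential lam a 1 (a 1) :=
    fun x => (ha 1 le_rfl).2 ⟨x, rfl⟩
  have hc := continuous_discretePotential h0 a 1
  have hpos : 0 < discretePotential lam a 1 (a 1) := by
    refine lt_of_lt_of_le ?_ (hle (-a 0))
    simp only [discretePotential, Finset.sum_range_one, powKernel]
    refine Real.rpow_pos_of_pos (norm_pos_iff.2 (sub_ne_zero.2 ?_)) _
    exact fun h => ne_neg_of_mem_unit_sphere ℝ (a 0) (Subtype.ext h.symm)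
  have := integral_pos_of_continuous (f := fun x =>
    discretePotential lam a 1 (a 1) - discretePotential lam a 1 x) (by fun_prop)
    (fun x => sub_nonneg.2 (hle x)) (x := a 0) (by
      have : discretePotential lam a 1 (a 0) = 0 := by simp [discretePotential, powKernel_self h0]
      rw [this, sub_zero]
      exact hpos.ne')
  rw [integral_sub (integrable_const _) (integrable_of_continuous_compact _ hc),
    integral_discretePotential h0] at this
  simpa using this

theorem IsGreedy.lt_discreteEnergy {lam : ℝ} (h0 : 0 < lam) {a : ℕ → UnitSphere d}
    (ha : IsGreedy lam a) {N : ℕ} (hN : 2 ≤ N) :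
    (N : ℝ) * ((N : ℝ) - 1) * continuousEnergy lam (uniformMeasure d)
      < discreteEnergy lam (sequenceSection a N) := by
  induction N, hN using Nat.le_induction with
  | base =>
    have h := continuousEnergy_lt_discretePotential_one h0 ha
    have h1 : discreteEnergy lam (sequenceSection a 0) = 0 := by simp [discreteEnergy]
    rw [discreteEnergy_sequenceSection_succ h0, discreteEnergy_sequenceSection_succ h0, h1]
    simp only [discretePotential, Finset.sum_range_zero] at h ⊢
    push_cast
    linarith
  | succ N hN ih =>
    have h := ha.mul_continuousEnergy_le h0 N
    rw [discreteEnergy_sequenceSection_succ h0]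
    push_cast
    linarith

/-! ### Counting measures: the upper bound and the limits. -/

instance countingMeasure_isProbabilityMeasure (a : ℕ → UnitSphere d) (N : ℕ) [NeZero N] :
    IsProbabilityMeasure (countingMeasure a N) := by
  refine ⟨?_⟩
  simp [countingMeasure, ENNReal.inv_mul_cancel (Nat.cast_ne_zero.2 (NeZero.ne N))]

theorem integral_countingMeasure (a : ℕ → UnitSphere d) (N : ℕ) {f : UnitSphere d → ℝ}
    (hf : Continuous f) :
    ∫ x, f x ∂(countingMeasure a N) = (N : ℝ)⁻¹ * ∑ k ∈ Finset.range N, f (a k) := by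
  unfold countingMeasure
  rw [integral_smul_measure, integral_finsetSum_measure fun k _ =>
    integrable_of_continuous_compact _ hf]
  simp

theorem mutualEnergy_countingMeasure {lam : ℝ} (h0 : 0 < lam) (a : ℕ → UnitSphere d) (N : ℕ) :
    mutualEnergy lam (countingMeasure a N) (countingMeasure a N)
      = discreteEnergy lam (sequenceSection a N) / (N : ℝ) ^ 2 := by
  have h : ∀ x, ∫ y, powKernel lam x y ∂(countingMeasure a N)
      = (N : ℝ)⁻¹ * ∑ k ∈ Finset.range N, powKernel lam x (a k) := fun x => by
    simp only [powKernel_comm lam x]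
    exact integral_countingMeasure a N (continuous_powKernel_left h0 x)
  unfold mutualEnergy
  simp only [h]
  rw [integral_const_mul, integral_countingMeasure a N (continuous_finsetSum _ fun k _ =>
    continuous_powKernel_left h0 (a k)), discreteEnergy_sequenceSection h0]
  ring

/-- This is where d ≥ 1 matters: S^0 has two points, and the strict upper bound needs a point
outside the configuration. -/
instance unitSphere_infinite [NeZero d] : Infinite (UnitSphere d) := by
  have hd := NeZero.pos d
  have hrank : 1 < Module.rank ℝ (EuclideanSpace ℝ (Fin (d + 1))) := by
    rw [← Module.finrank_eq_rank, finrank_euclideanSpace_fin]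
    exact_mod_cast Nat.lt_add_of_pos_left hd
  refine Set.infinite_coe_iff.2
    ((isPreconnected_sphere hrank 0 1).infinite_of_nontrivial ?_)
  obtain ⟨x, hx⟩ := (NormedSpace.sphere_nonempty
    (x := (0 : EuclideanSpace ℝ (Fin (d + 1)))) (r := 1)).2 zero_le_one
  exact ⟨x, hx, -x, by simpa using hx, fun h =>
    ne_neg_of_mem_unit_sphere ℝ (⟨x, hx⟩ : UnitSphere d) (Subtype.ext h)⟩

theorem discreteEnergy_lt {lam : ℝ} [NeZero d] (h0 : 0 < lam) (h2 : lam < 2)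
    (a : ℕ → UnitSphere d) (N : ℕ) [NeZero N] :
    discreteEnergy lam (sequenceSection a N)
      < (N : ℝ) ^ 2 * continuousEnergy lam (uniformMeasure d) := by
  have hN : (0 : ℝ) < (N : ℝ) ^ 2 := by
    have := NeZero.pos N
    positivity
  rw [← div_lt_iff₀' hN, ← mutualEnergy_countingMeasure h0]
  refine lt_of_le_of_ne (mutualEnergy_self_le_continuousEnergy h0 h2 _) fun h => ?_
  -- This function vanishes at every a_k but not identically, so its integral is zero for the
  -- counting measure and positive for the uniform one.
  have hf : Continuous fun x : UnitSphere d => ∏ k ∈ Finset.range N, dist x (a k) := by fun_prop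
  have heq := integral_eq_of_mutualEnergy_self_eq h0 h2 _ h hf
  obtain ⟨x, hx⟩ := Infinite.exists_notMem_finset (Finset.image a (Finset.range N))
  have hpos := integral_pos_of_continuous hf
    (fun y => Finset.prod_nonneg fun k _ => dist_nonneg) (x := x) (by
      refine Finset.prod_ne_zero_iff.2 fun k hk => dist_ne_zero.2 ?_
      rintro rfl
      exact hx (Finset.mem_image_of_mem a hk))
  rw [← heq, integral_countingMeasure a N hf, Finset.sum_eq_zero fun k hk =>
    Finset.prod_eq_zero hk (dist_self (a k))] at hpos
  simp at hpos

theorem IsGreedy.tendsto_discreteEnergy_div_sq {lam : ℝ} [NeZero d] (h0 : 0 < lam) (h2 : lam < 2)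
    {a : ℕ → UnitSphere d} (ha : IsGreedy lam a) :
    Tendsto (fun N : ℕ => discreteEnergy lam (sequenceSection a N) / (N : ℝ) ^ 2) atTop
      (𝓝 (continuousEnergy lam (uniformMeasure d))) := by
  have hlow : Tendsto (fun N : ℕ => (1 - (N : ℝ)⁻¹) * continuousEnergy lam (uniformMeasure d))
      atTop (𝓝 (continuousEnergy lam (uniformMeasure d))) := by
    simpa using (tendsto_inv_atTop_nhds_zero_nat.const_sub (1 : ℝ)).mul_const
      (continuousEnergy lam (uniformMeasure d))
  refine tendsto_of_tendsto_of_tendsto_of_le_of_le' hlow tendsto_const_nhds ?_ ?_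
  · filter_upwards [eventually_ge_atTop 2] with N hN
    have hN0 : (0 : ℝ) < N := by positivity
    rw [le_div_iff₀ (by positivity)]
    refine le_trans (le_of_eq ?_) (ha.lt_discreteEnergy h0 hN).le
    field_simp
  · filter_upwards [eventually_ge_atTop 1] with N hN
    have : NeZero N := ⟨by omega⟩
    rw [div_le_iff₀' (by positivity)]
    exact (discreteEnergy_lt h0 h2 a N).le

theorem IsGreedy.weakStarTendsto_countingMeasure {lam : ℝ} [NeZero d] (h0 : 0 < lam)
    (h2 : lam < 2) {a : ℕ → UnitSphere d} (ha : IsGreedy lam a) :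
    WeakStarTendsto (countingMeasure a) (uniformMeasure d) := by
  -- The index is shifted since the counting measure for N = 0 is zero, not a probability measure.
  have h := weakStarTendsto_uniformMeasure_of_tendsto_energy h0 h2
    (fun n => countingMeasure a (n + 1)) (by
      simp only [mutualEnergy_countingMeasure h0]
      exact (tendsto_add_atTop_iff_nat 1).2 (ha.tendsto_discreteEnergy_div_sq h0 h2))
  exact fun f hf => (tendsto_add_atTop_iff_nat 1).1 (h f hf)

theorem theorem3p1 (d : ℕ) (hd : 1 ≤ d) (lam : ℝ) (hlam0 : 0 < lam) (hlam2 : lam < 2)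
    (a : ℕ → UnitSphere d) (ha : IsGreedy lam a) :
    (∀ N : ℕ, 2 ≤ N →
      (N : ℝ) * ((N : ℝ) - 1) * continuousEnergy lam (uniformMeasure d)
          < discreteEnergy lam (sequenceSection a N) ∧
        discreteEnergy lam (sequenceSection a N)
          < (N : ℝ) ^ 2 * continuousEnergy lam (uniformMeasure d)) ∧
    Tendsto (fun N : ℕ => discreteEnergy lam (sequenceSection a N) / (N : ℝ) ^ 2) atTop
      (𝓝 (continuousEnergy lam (uniformMeasure d))) ∧
    WeakStarTendsto (countingMeasure a) (uniformMeasure d) := by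
  have : NeZero d := ⟨by omega⟩
  refine ⟨fun N hN => ⟨ha.lt_discreteEnergy hlam0 hN, ?_⟩,
    ha.tendsto_discreteEnergy_div_sq hlam0 hlam2,
    ha.weakStarTendsto_countingMeasure hlam0 hlam2⟩
  have : NeZero N := ⟨by omega⟩
  exact discreteEnergy_lt hlam0 hlam2 a N
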